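/- **Theorem 2.1.** Let $K$ and $C$ be convex bodies (compact convex sets with non-empty interior) in $\mathbb{E}^d$, $d\ge 2$, and let $m\ge 1$ and $n\ge 1$ be integers. Definitions. For a convex body $L$ and a hyperplane $H$ let $w(L,H)$ be the distance between the two supporting hyperplanes of $L$ parallel to $H$; put $w_C(L,H)=w(L,H)/w(C,H)$ and let $w_C(L)=\min_H w_C(L,H)$ be the minimal $C$-width of $L$. The $C$-inradius $r$ of $L$ is the largest $\lambda>0$ such that a translate of $\lambda C$ is contained in $L$. For $0<\rho\le r$ the $\rho C$-rounded body $L^{\rho C}$ of $L$ is the union of all translates of $\rho C$ that are contained in $L$. For an integer $k\ge 1$ there is a unique $\rho\in(0,r]$ with $w_C(L^{\rho C})=k\rho$; it is called the $k$th successive $C$-inradius of $L$ and denoted by $r_C(L,k)$. A convex body is sliced into $n$ pieces by $n-1$ successive hyperplane cuts if one starts from the body itself as the only piece and, in each of $n-1$ steps, divides one of the current pieces by a hyperplane through its interior into its two (closed) parts, leaving the other pieces unchanged. Claim. Over all ways of slicing $K$ into $n$ pieces $K_1,\dots,K_n$ by $n-1$ successive hyperplane cuts, the minimum of $\max_{1\le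 i\le n} r_C(K_i,m)$ exists and equals $r_C(K,mn)$. Moreover, put $\rho=r_C(K,mn)$, let $H$ be any hyperplane with $w_C(K^{\rho C},H)=w_C(K^{\rho C})$ (such $H$ exist), and take the $n-1$ hyperplanes parallel to $H$ that divide the strip between the two supporting hyperplanes of $K^{\rho C}$ parallel to $H$ into $n$ strips of equal width. Slicing $K$ successively by these $n-1$ hyperplanes gives $n$ pieces whose greatest $m$th successive $C$-inradius is $r_C(K,mn)$, so that the minimum is attained there. -/

import Mathlib

noncomputable section

namespace SuccessiveInradii

/-- Euclidean `d`-space. -/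
abbrev E (d : ℕ) : Type := EuclideanSpace ℝ (Fin d)

/-- Unit vectors, the (oriented) unit normals of hyperplanes. -/
abbrev UnitVec (d : ℕ) : Type := Metric.sphere (0 : E d) 1

/-- A convex body: a compact convex set with non-empty interior. -/
structure IsConvexBody {d : ℕ} (K : Set (E d)) : Prop where
  isCompact : IsCompact K
  convex : Convex ℝ K
  interior_nonempty : (interior K).Nonempty

/-- The level of the upper supporting hyperplane of `K` with unit normal `u`. -/
def upperLevel {d : ℕ} (K : Set (E d)) (u : UnitVec d) : ℝ :=
  sSup ((fun x : E d => inner ℝ (u : E d) x) '' K)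

/-- The level of the lower supporting hyperplane of `K` with unit normal `u`. -/
def lowerLevel {d : ℕ} (K : Set (E d)) (u : UnitVec d) : ℝ :=
  sInf ((fun x : E d => inner ℝ (u : E d) x) '' K)

/-- `w(K, H)` for the hyperplanes `H` with unit normal `u`: the distance between the two
supporting hyperplanes of `K` that are orthogonal to `u`. -/
def width {d : ℕ} (K : Set (E d)) (u : UnitVec d) : ℝ :=
  upperLevel K u - lowerLevel K u

/-- The `C`-width of `K` parallel to the hyperplanes with unit normal `u`. -/
def relWidth {d : ℕ} (C K : Set (E d)) (u : UnitVec d) : ℝ :=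
  width K u / width C u

/-- The minimal `C`-width of `K`. -/
def minRelWidth {d : ℕ} (C K : Set (E d)) : ℝ :=
  ⨅ u : UnitVec d, relWidth C K u

/-- The translate `t + ρ C` of `ρ C`. -/
def homothet {d : ℕ} (t : E d) (ρ : ℝ) (C : Set (E d)) : Set (E d) :=
  (fun x : E d => t + ρ • x) '' C

/-- The `C`-inradius of `K`: the factor of the largest positive homothetic copy of `C`
a translate of which is contained in `K`. -/
def inradius {d : ℕ} (C K : Set (E d)) : ℝ :=
  sSup {ρ : ℝ | 0 < ρ ∧ ∃ t : E d, homothet t ρ C ⊆ K}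

/-- The `ρ C`-rounded body of `K`: the union of all translates of `ρ C` covered by `K`. -/
def roundedBody {d : ℕ} (C K : Set (E d)) (ρ : ℝ) : Set (E d) :=
  ⋃ t ∈ {t : E d | homothet t ρ C ⊆ K}, homothet t ρ C

/-- The defining property of the `m`-th successive `C`-inradius of `K`. -/
def IsSuccessiveInradius {d : ℕ} (C K : Set (E d)) (m : ℕ) (ρ : ℝ) : Prop :=
  0 < ρ ∧ ρ ≤ inradius C K ∧ minRelWidth C (roundedBody C K ρ) = m * ρ

/-- The `m`-th successive `C`-inradius `r_C(K, m)` of `K`, i.e. the element of the set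
below, which is a singleton for convex bodies `C`, `K` and `m ≥ 1`. -/
def successiveInradius {d : ℕ} (C K : Set (E d)) (m : ℕ) : ℝ :=
  sSup {ρ : ℝ | IsSuccessiveInradius C K m ρ}

/-- The hyperplane `{x | ⟨u, x⟩ = t}`, given by a unit normal `u` and a level `t`. -/
structure Hyperplane (d : ℕ) where
  normal : UnitVec d
  level : ℝ

/-- The points of a hyperplane. -/
def Hyperplane.points {d : ℕ} (H : Hyperplane d) : Set (E d) :=
  {x | inner ℝ (H.normal : E d) x = H.level}

/-- One of the two closed half-spaces bounded by a hyperplane. -/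
def Hyperplane.lower {d : ℕ} (H : Hyperplane d) : Set (E d) :=
  {x | inner ℝ (H.normal : E d) x ≤ H.level}

/-- The other closed half-space bounded by a hyperplane. -/
def Hyperplane.upper {d : ℕ} (H : Hyperplane d) : Set (E d) :=
  {x | H.level ≤ inner ℝ (H.normal : E d) x}

/-- `SlicedBy K cuts pieces`: the successive hyperplane cuts listed (chronologically) in `cuts`
slice `K` into `pieces`. Each cut divides exactly one of the pieces present at that moment, into
its two parts on either side of the hyperplane, and leaves the other pieces as they are. That the
hyperplane divides the piece means that it passes through the interior of the piece. -/
inductive SlicedBy {d : ℕ} (K : Set (E d)) : List (Hyperplane d) → Multiset (Set (E d)) → Prop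
  | uncut : SlicedBy K [] {K}
  | cut (cuts : List (Hyperplane d)) (P : Set (E d)) (rest : Multiset (Set (E d)))
      (H : Hyperplane d) (before : SlicedBy K cuts (P ::ₘ rest))
      (divides : (interior P ∩ H.points).Nonempty) :
      SlicedBy K (cuts ++ [H]) ((P ∩ H.lower) ::ₘ (P ∩ H.upper) ::ₘ rest)

/-- `k` successive cuts produce `k + 1` pieces. -/
theorem SlicedBy.card_pieces {d : ℕ} {K : Set (E d)} {cuts : List (Hyperplane d)}
    {pieces : Multiset (Set (E d))} (h : SlicedBy K cuts pieces) :
    pieces.card = cuts.length + 1 := by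
  induction h with
  | uncut => simp
  | cut cuts P rest H before divides ih => simpa using ih

/-- The pieces of a sliced convex body are convex bodies. -/
theorem SlicedBy.isConvexBody {d : ℕ} {K : Set (E d)} (hK : IsConvexBody K)
    {cuts : List (Hyperplane d)} {pieces : Multiset (Set (E d))} (h : SlicedBy K cuts pieces) :
    ∀ P ∈ pieces, IsConvexBody P := by
  induction h with
  | uncut => simpa using hK
  | cut cuts P rest H before divides ih =>
    have hP : IsConvexBody P := ih P (Multiset.mem_cons_self _ _)
    obtain ⟨x, hx, hxH⟩ := divides
    have hxH : inner ℝ (H.normal : E d) x = H.level := hxH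
    have hu : inner ℝ (H.normal : E d) (H.normal : E d) = 1 := by
      have h1 : ‖(H.normal : E d)‖ = 1 := by simp
      rw [real_inner_self_eq_norm_sq, h1]; norm_num
    have hcont : Continuous fun y : E d => inner ℝ (H.normal : E d) y := by fun_prop
    have hlin : IsLinearMap ℝ fun y : E d => inner ℝ (H.normal : E d) y :=
      (innerₛₗ ℝ (H.normal : E d)).isLinear
    obtain ⟨ε, hε, hball⟩ := Metric.isOpen_iff.1 isOpen_interior x hx
    have hmem : ∀ c : ℝ, |c| < ε → x + c • (H.normal : E d) ∈ interior P := by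
      intro c hc
      apply hball
      simpa [Metric.mem_ball, dist_eq_norm, norm_smul] using hc
    have hval : ∀ c : ℝ, inner ℝ (H.normal : E d) (x + c • (H.normal : E d)) = H.level + c := by
      intro c
      rw [inner_add_right, real_inner_smul_right, hu, hxH, mul_one]
    have hlow : IsConvexBody (P ∩ H.lower) := by
      refine ⟨hP.isCompact.inter_right (isClosed_le hcont continuous_const),
        hP.convex.inter (convex_halfSpace_le hlin _), x + (-(ε / 2)) • (H.normal : E d), ?_⟩
      rw [interior_inter]
      refine ⟨hmem _ (by rw [abs_neg, abs_of_pos (by linarith)]; linarith), ?_⟩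
      refine interior_maximal (s := H.lower) (t := {y | inner ℝ (H.normal : E d) y < H.level})
        (fun y (hy : inner ℝ (H.normal : E d) y < H.level) => hy.le) (isOpen_lt hcont continuous_const) ?_
      change inner ℝ (H.normal : E d) _ < H.level
      rw [hval]; linarith
    have hupp : IsConvexBody (P ∩ H.upper) := by
      refine ⟨hP.isCompact.inter_right (isClosed_le continuous_const hcont),
        hP.convex.inter (convex_halfSpace_ge hlin _), x + (ε / 2) • (H.normal : E d), ?_⟩
      rw [interior_inter]
      refine ⟨hmem _ (by rw [abs_of_pos (by linarith)]; linarith), ?_⟩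
      refine interior_maximal (s := H.upper) (t := {y | H.level < inner ℝ (H.normal : E d) y})
        (fun y (hy : H.level < inner ℝ (H.normal : E d) y) => hy.le) (isOpen_lt continuous_const hcont) ?_
      change H.level < inner ℝ (H.normal : E d) _
      rw [hval]; linarith
    intro Q hQ
    rcases Multiset.mem_cons.1 hQ with rfl | hQ
    · exact hlow
    rcases Multiset.mem_cons.1 hQ with rfl | hQ
    · exact hupp
    · exact ih Q (Multiset.mem_cons_of_mem hQ)

/-- `M` is the greatest `m`-th successive `C`-inradius of the pieces. -/
def IsGreatestInradius {d : ℕ} (C : Set (E d)) (m : ℕ) (pieces : Multiset (Set (E d)))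
    (M : ℝ) : Prop :=
  IsGreatest {r : ℝ | ∃ P ∈ pieces, r = successiveInradius C P m} M

/-- The `n - 1` hyperplanes with unit normal `u` that are equally spaced along the width of `L`
in direction `u`: they divide the strip between the two supporting hyperplanes of `L` orthogonal
to `u` into `n` strips of equal width. -/
def equallySpacedCuts {d : ℕ} (L : Set (E d)) (u : UnitVec d) (n : ℕ) : List (Hyperplane d) :=
  (List.range (n - 1)).map fun i =>
    { normal := u
      level := lowerLevel L u + ((i : ℝ) + 1) * (width L u / n) }

end SuccessiveInradii

end

open SuccessiveInradii

namespace SuccessiveInradii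

open Set

variable {d : ℕ} {C L M S : Set (E d)} {u : UnitVec d} {ρ σ : ℝ}

/-! ### Widths and supporting levels in a direction -/

section Width

/-! Write w for the minimal C-width and L_ρ for the erosion, the set of t with t + ρC ⊆ L. The
rounded body is L_ρ + ρC, so its minimal C-width is w(L_ρ) + ρ, and r_C(L, k) is the root of w(L_ρ)
+ ρ = kρ. The left side does not increase with ρ while L_ρ is nonempty, so the root is unique; a
compactness argument gives its existence.

Lower bound. The function w(L_ρ) + ρ is subadditive under a hyperplane cut
(`minRelWidth_erosion_le_cut`), hence under every successive slicing of K. If each piece had its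
m-th inradius below r = r_C(K, mn), then for some ρ slightly below r each of the n pieces would
contribute at most mρ, against w(K_ρ) + ρ > mnρ.

Subadditivity is the heart of the proof. Eroding the two parts of P amounts to removing from S = P_ρ
a slab of relative width ρ, so the claim is w(S) ≤ w(S₁) + w(S₂) + ρ for the two remnants
(`minRelWidth_le_add_add`). A vector v that crosses the slab is found along a long chord of S, and a
smaller copy T of S has T and T + v inside S. Each x in T has x in S₁ or x + v in S₂, so T is
covered by two planks, one around S₁ and one around S₂ - v. Were the claim false, T would exceed
both planks by too much, contrary to the planar estimate `mul_le_mul_of_subset_two_planks`.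

Upper bound. The equally spaced cuts leave each piece only a strip of relative width mρ of the
rounded body of K. The rounded body of the piece lies in that strip, so its m-th inradius is at most
ρ. -/

theorem continuous_inner_unitVec (u : UnitVec d) :
    Continuous fun x : E d => inner ℝ (u : E d) x := by fun_prop

theorem inner_le_upperLevel (hL : IsCompact L) (u : UnitVec d) {x : E d} (hx : x ∈ L) :
    inner ℝ (u : E d) x ≤ upperLevel L u :=
  le_csSup (hL.image (continuous_inner_unitVec u)).bddAbove (mem_image_of_mem _ hx)

theorem lowerLevel_le_inner (hL : IsCompact L) (u : UnitVec d) {x : E d} (hx : x ∈ L) :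
    lowerLevel L u ≤ inner ℝ (u : E d) x :=
  csInf_le (hL.image (continuous_inner_unitVec u)).bddBelow (mem_image_of_mem _ hx)

theorem exists_inner_eq_upperLevel (hL : IsCompact L) (hne : L.Nonempty) (u : UnitVec d) :
    ∃ x ∈ L, inner ℝ (u : E d) x = upperLevel L u :=
  (hL.image (continuous_inner_unitVec u)).sSup_mem (hne.image _)

theorem exists_inner_eq_lowerLevel (hL : IsCompact L) (hne : L.Nonempty) (u : UnitVec d) :
    ∃ x ∈ L, inner ℝ (u : E d) x = lowerLevel L u :=
  (hL.image (continuous_inner_unitVec u)).sInf_mem (hne.image _)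

theorem inner_sub_inner_le_width (hL : IsCompact L) (u : UnitVec d) {x y : E d} (hx : x ∈ L)
    (hy : y ∈ L) : inner ℝ (u : E d) x - inner ℝ (u : E d) y ≤ width L u :=
  sub_le_sub (inner_le_upperLevel hL u hx) (lowerLevel_le_inner hL u hy)

theorem exists_inner_sub_inner_eq_width (hL : IsCompact L) (hne : L.Nonempty) (u : UnitVec d) :
    ∃ x ∈ L, ∃ y ∈ L, inner ℝ (u : E d) x - inner ℝ (u : E d) y = width L u := by
  obtain ⟨x, hx, hxu⟩ := exists_inner_eq_upperLevel hL hne u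
  obtain ⟨y, hy, hyu⟩ := exists_inner_eq_lowerLevel hL hne u
  exact ⟨x, hx, y, hy, by rw [hxu, hyu, width]⟩

/-- Comes from the default values of `sSup` and `sInf` at ∅. It makes a piece containing no
translate of ρC contribute just ρ to the sum over the pieces. -/
theorem width_empty (u : UnitVec d) : width (∅ : Set (E d)) u = 0 := by
  simp [width, upperLevel, lowerLevel]

theorem width_nonneg (hL : IsCompact L) (u : UnitVec d) : 0 ≤ width L u := by
  rcases L.eq_empty_or_nonempty with rfl | ⟨x, hx⟩
  · rw [width_empty]
  · simpa using inner_sub_inner_le_width hL u hx hx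

theorem width_le_of_forall (hL : IsCompact L) (hne : L.Nonempty) {a : ℝ}
    (h : ∀ x ∈ L, ∀ y ∈ L, inner ℝ (u : E d) x - inner ℝ (u : E d) y ≤ a) : width L u ≤ a := by
  obtain ⟨x, hx, y, hy, hxy⟩ := exists_inner_sub_inner_eq_width hL hne u
  exact hxy ▸ h x hx y hy

theorem width_mono (hM : IsCompact M) (hne : M.Nonempty) (hL : IsCompact L) (h : M ⊆ L) :
    width M u ≤ width L u :=
  width_le_of_forall hM hne fun _ hx _ hy => inner_sub_inner_le_width hL u (h hx) (h hy)

theorem inner_unitVec_self (u : UnitVec d) : inner ℝ (u : E d) (u : E d) = 1 := by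
  rw [real_inner_self_eq_norm_sq, norm_eq_of_mem_sphere, one_pow]

/-- A neighbourhood of a point contains points slightly above and below it. -/
theorem exists_add_smul_mem_interior {x : E d} (hx : x ∈ interior L) (u : UnitVec d) :
    ∃ ε : ℝ, 0 < ε ∧ x + ε • (u : E d) ∈ interior L ∧ x - ε • (u : E d) ∈ interior L := by
  obtain ⟨ε, hε, hball⟩ := Metric.isOpen_iff.1 isOpen_interior x hx
  refine ⟨ε / 2, by linarith, hball ?_, hball ?_⟩ <;>
  · simp only [Metric.mem_ball, dist_eq_norm, add_sub_cancel_left, sub_sub_cancel_left, norm_neg,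
      norm_smul, norm_eq_of_mem_sphere, Real.norm_eq_abs, abs_of_pos (half_pos hε)]
    linarith

theorem width_pos (hC : IsConvexBody C) (u : UnitVec d) : 0 < width C u := by
  obtain ⟨x, hx⟩ := hC.interior_nonempty
  obtain ⟨ε, hε, h, -⟩ := exists_add_smul_mem_interior hx u
  have := inner_sub_inner_le_width hC.isCompact u (interior_subset h) (interior_subset hx)
  rw [inner_add_right, real_inner_smul_right, inner_unitVec_self] at this
  linarith

theorem IsConvexBody.nonempty (hC : IsConvexBody C) : C.Nonempty :=
  hC.interior_nonempty.mono interior_subset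

theorem continuous_upperLevel (hL : IsCompact L) : Continuous (upperLevel L) :=
  hL.continuous_sSup (f := fun (u : UnitVec d) (x : E d) => inner ℝ (u : E d) x) (by fun_prop)

theorem continuous_lowerLevel (hL : IsCompact L) : Continuous (lowerLevel L) :=
  hL.continuous_sInf (f := fun (u : UnitVec d) (x : E d) => inner ℝ (u : E d) x) (by fun_prop)

theorem continuous_width (hL : IsCompact L) : Continuous (width L) :=
  (continuous_upperLevel hL).sub (continuous_lowerLevel hL)

end Width

/-! ### Homothetic copies -/

section Homothet

theorem mem_homothet_iff {t x : E d} : x ∈ homothet t ρ C ↔ ∃ c ∈ C, t + ρ • c = x := Iff.rfl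

theorem IsCompact.homothet (hC : IsCompact C) (t : E d) (ρ : ℝ) : IsCompact (homothet t ρ C) :=
  hC.image (by fun_prop)

theorem homothet_zero (hC : C.Nonempty) (t : E d) : homothet t 0 C = {t} := by
  simp [homothet, hC]

theorem width_homothet (hC : IsCompact C) (hne : C.Nonempty) (t : E d) (hρ : 0 ≤ ρ)
    (u : UnitVec d) : width (homothet t ρ C) u = ρ * width C u := by
  apply le_antisymm
  · apply width_le_of_forall (IsCompact.homothet hC t ρ) (hne.image _)
    rintro _ ⟨x, hx, rfl⟩ _ ⟨y, hy, rfl⟩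
    simp only [inner_add_right, real_inner_smul_right]
    nlinarith [inner_sub_inner_le_width hC u hx hy]
  · obtain ⟨x, hx, y, hy, hxy⟩ := exists_inner_sub_inner_eq_width hC hne u
    have := inner_sub_inner_le_width (IsCompact.homothet hC t ρ) u
      (mem_homothet_iff.2 ⟨x, hx, rfl⟩) (mem_homothet_iff.2 ⟨y, hy, rfl⟩)
    simp only [inner_add_right, real_inner_smul_right] at this
    rw [← hxy]; linarith

end Homothet

/-! ### The minimal relative width -/

section MinRelWidth

theorem relWidth_nonneg (hC : IsCompact C) (hL : IsCompact L) (u : UnitVec d) :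
    0 ≤ relWidth C L u :=
  div_nonneg (width_nonneg hL u) (width_nonneg hC u)

theorem minRelWidth_le (hC : IsCompact C) (hL : IsCompact L) (u : UnitVec d) :
    minRelWidth C L ≤ relWidth C L u :=
  ciInf_le ⟨0, by rintro _ ⟨v, rfl⟩; exact relWidth_nonneg hC hL v⟩ u

theorem minRelWidth_nonneg (hC : IsCompact C) (hL : IsCompact L) : 0 ≤ minRelWidth C L :=
  Real.iInf_nonneg fun u => relWidth_nonneg hC hL u

theorem minRelWidth_mul_width_le (hC : IsConvexBody C) (hL : IsCompact L) (u : UnitVec d) :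
    minRelWidth C L * width C u ≤ width L u :=
  (le_div_iff₀ (width_pos hC u)).1 (minRelWidth_le hC.isCompact hL u)

theorem minRelWidth_empty : minRelWidth C (∅ : Set (E d)) = 0 := by
  simp [minRelWidth, relWidth, width_empty]

variable [Nonempty (UnitVec d)]

theorem le_minRelWidth (hC : IsConvexBody C) {a : ℝ} (h : ∀ u, a * width C u ≤ width L u) :
    a ≤ minRelWidth C L :=
  le_ciInf fun u => (le_div_iff₀ (width_pos hC u)).2 (h u)

theorem exists_relWidth_eq_minRelWidth (hC : IsConvexBody C) (hL : IsCompact L) :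
    ∃ u : UnitVec d, relWidth C L u = minRelWidth C L := by
  have hcont : Continuous (relWidth C L) :=
    (continuous_width hL).div (continuous_width hC.isCompact) fun u => (width_pos hC u).ne'
  obtain ⟨u, -, hu⟩ := isCompact_univ.exists_isMinOn univ_nonempty hcont.continuousOn
  exact ⟨u, le_antisymm (le_ciInf fun v => hu (mem_univ v)) (minRelWidth_le hC.isCompact hL u)⟩

theorem exists_width_eq_minRelWidth_mul (hC : IsConvexBody C) (hL : IsCompact L) :
    ∃ u : UnitVec d, width L u = minRelWidth C L * width C u := by
  obtain ⟨u, hu⟩ := exists_relWidth_eq_minRelWidth hC hL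
  exact ⟨u, by rw [← hu, relWidth, div_mul_cancel₀ _ (width_pos hC u).ne']⟩

theorem minRelWidth_mono (hC : IsConvexBody C) (hM : IsCompact M) (hne : M.Nonempty)
    (hL : IsCompact L) (h : M ⊆ L) : minRelWidth C M ≤ minRelWidth C L :=
  le_minRelWidth hC fun u => (minRelWidth_mul_width_le hC hM u).trans (width_mono hM hne hL h)

theorem minRelWidth_pos (hC : IsConvexBody C) (hL : IsConvexBody L) : 0 < minRelWidth C L := by
  obtain ⟨u, hu⟩ := exists_relWidth_eq_minRelWidth hC hL.isCompact
  exact hu ▸ div_pos (width_pos hL u) (width_pos hC u)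

theorem minRelWidth_homothet (hC : IsConvexBody C) (hL : IsCompact L) (hne : L.Nonempty)
    (t : E d) (hρ : 0 ≤ ρ) : ρ * minRelWidth C L ≤ minRelWidth C (homothet t ρ L) :=
  le_minRelWidth hC fun u => by
    rw [width_homothet hL hne t hρ, mul_assoc]
    exact mul_le_mul_of_nonneg_left (minRelWidth_mul_width_le hC hL u) hρ

end MinRelWidth

/-! ### Erosions and rounded bodies -/

section Erosion

/-- The erosion of `L` by `ρ C`: the translation vectors that move `ρ C` into `L`. -/
def erosion (C L : Set (E d)) (ρ : ℝ) : Set (E d) :=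
  {t | homothet t ρ C ⊆ L}

theorem mem_erosion_iff {t : E d} : t ∈ erosion C L ρ ↔ ∀ c ∈ C, t + ρ • c ∈ L := by
  simp [erosion, homothet, subset_def]

theorem erosion_zero (hC : C.Nonempty) : erosion C L 0 = L := by
  ext t; simp [erosion, homothet_zero hC]

theorem convex_erosion (hL : Convex ℝ L) : Convex ℝ (erosion C L ρ) := by
  intro x hx y hy a b ha hb hab
  rw [mem_erosion_iff] at *
  intro c hc
  convert hL (hx c hc) (hy c hc) ha hb hab using 1
  rw [smul_add, smul_add, add_add_add_comm, ← add_smul, hab, one_smul]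

theorem isClosed_setOf_mem_erosion (hL : IsClosed L) :
    IsClosed {p : ℝ × E d | p.2 ∈ erosion C L p.1} := by
  simp only [mem_erosion_iff, ofPred_forall]
  exact isClosed_iInter fun c => isClosed_iInter fun _ => hL.preimage (by fun_prop)

theorem isCompact_setOf_mem_erosion (hC : C.Nonempty) (hL : IsCompact L) (R : ℝ) :
    IsCompact {p : ℝ × E d | p.1 ∈ Icc 0 R ∧ p.2 ∈ erosion C L p.1} := by
  obtain ⟨c, hc⟩ := hC
  have hK : IsCompact ((fun p : ℝ × E d => (p.1, p.2 - p.1 • c)) '' (Icc 0 R ×ˢ L)) :=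
    (isCompact_Icc.prod hL).image (by fun_prop)
  refine hK.of_isClosed_subset
    ((isClosed_Icc.preimage continuous_fst).inter (isClosed_setOf_mem_erosion hL.isClosed)) ?_
  rintro ⟨r, x⟩ ⟨hr, hx⟩
  exact ⟨(r, x + r • c), ⟨hr, mem_erosion_iff.1 hx c hc⟩, by simp⟩

theorem isCompact_erosion (hC : C.Nonempty) (hL : IsCompact L) : IsCompact (erosion C L ρ) := by
  obtain ⟨c, hc⟩ := hC
  refine (hL.image (f := fun x => x - ρ • c) (by fun_prop)).of_isClosed_subset
    ((isClosed_setOf_mem_erosion hL.isClosed).preimage (Continuous.prodMk_right ρ)) ?_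
  intro x hx
  exact ⟨x + ρ • c, mem_erosion_iff.1 hx c hc, by simp⟩

/-- Eroding less leaves at least a translate-sum with the difference. -/
theorem add_smul_mem_erosion (hC : Convex ℝ C) {t c : E d} (hρ : 0 ≤ ρ) (hρσ : ρ ≤ σ)
    (ht : t ∈ erosion C L σ) (hc : c ∈ C) : t + (σ - ρ) • c ∈ erosion C L ρ := by
  rw [mem_erosion_iff] at *
  intro c' hc'
  rcases hρσ.eq_or_lt with rfl | hlt
  · simpa using ht c' hc'
  have hσ : 0 < σ := hρ.trans_lt hlt
  -- By convexity of C, (σ - ρ)c + ρc' is σ times a point of C.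
  convert ht _ (hC hc hc' (a := (σ - ρ) / σ) (b := ρ / σ) (div_nonneg (by linarith) hσ.le)
    (div_nonneg hρ hσ.le) (by field_simp; ring)) using 1
  rw [smul_add, smul_smul, smul_smul, mul_div_cancel₀ _ hσ.ne', mul_div_cancel₀ _ hσ.ne', add_assoc]

theorem mem_roundedBody_iff {x : E d} :
    x ∈ roundedBody C L ρ ↔ ∃ t ∈ erosion C L ρ, ∃ c ∈ C, t + ρ • c = x := by
  simp [roundedBody, erosion, mem_homothet_iff]

theorem roundedBody_subset : roundedBody C L ρ ⊆ L :=
  iUnion₂_subset fun _ ht => ht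

theorem roundedBody_mono (h : M ⊆ L) : roundedBody C M ρ ⊆ roundedBody C L ρ :=
  biUnion_subset_biUnion_left fun _ ht => ht.trans h

theorem isCompact_roundedBody (hC : IsCompact C) (hne : C.Nonempty) (hL : IsCompact L) :
    IsCompact (roundedBody C L ρ) := by
  convert ((isCompact_erosion (ρ := ρ) hne hL).prod hC).image
    (f := fun p : E d × E d => p.1 + ρ • p.2) (by fun_prop) using 1
  ext x
  simp [mem_roundedBody_iff, and_assoc]

theorem roundedBody_nonempty (hC : C.Nonempty) (h : (erosion C L ρ).Nonempty) :
    (roundedBody C L ρ).Nonempty := by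
  obtain ⟨t, ht⟩ := h
  obtain ⟨c, hc⟩ := hC
  exact ⟨_, mem_roundedBody_iff.2 ⟨t, ht, c, hc, rfl⟩⟩

theorem width_roundedBody (hC : IsConvexBody C) (hL : IsCompact L) (hρ : 0 ≤ ρ)
    (h : (erosion C L ρ).Nonempty) (u : UnitVec d) :
    width (roundedBody C L ρ) u = width (erosion C L ρ) u + ρ * width C u := by
  have hR := isCompact_roundedBody (ρ := ρ) hC.isCompact hC.nonempty hL
  have hE := isCompact_erosion (ρ := ρ) hC.nonempty hL
  apply le_antisymm
  · apply width_le_of_forall hR (roundedBody_nonempty hC.nonempty h)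
    intro x hx y hy
    obtain ⟨t, ht, c, hc, rfl⟩ := mem_roundedBody_iff.1 hx
    obtain ⟨t', ht', c', hc', rfl⟩ := mem_roundedBody_iff.1 hy
    simp only [inner_add_right, real_inner_smul_right]
    nlinarith [inner_sub_inner_le_width hC.isCompact u hc hc', inner_sub_inner_le_width hE u ht ht']
  · obtain ⟨t, ht, t', ht', htt'⟩ := exists_inner_sub_inner_eq_width hE h u
    obtain ⟨c, hc, c', hc', hcc'⟩ := exists_inner_sub_inner_eq_width hC.isCompact hC.nonempty u
    have := inner_sub_inner_le_width hR u (mem_roundedBody_iff.2 ⟨t, ht, c, hc, rfl⟩)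
      (mem_roundedBody_iff.2 ⟨t', ht', c', hc', rfl⟩)
    simp only [inner_add_right, real_inner_smul_right] at this
    rw [← htt', ← hcc']; linarith

/-- The summand ρC raises every relative width by exactly ρ. This replaces rounded bodies by
erosions, which behave simply under intersection with half-spaces. -/
theorem minRelWidth_roundedBody [Nonempty (UnitVec d)] (hC : IsConvexBody C) (hL : IsCompact L)
    (hρ : 0 ≤ ρ) (h : (erosion C L ρ).Nonempty) :
    minRelWidth C (roundedBody C L ρ) = minRelWidth C (erosion C L ρ) + ρ := by
  have hE := isCompact_erosion (ρ := ρ) hC.nonempty hL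
  apply le_antisymm
  · obtain ⟨u, hu⟩ := exists_width_eq_minRelWidth_mul hC hE
    have := minRelWidth_mul_width_le hC
      (isCompact_roundedBody (ρ := ρ) hC.isCompact hC.nonempty hL) u
    rw [width_roundedBody hC hL hρ h, hu, ← add_mul] at this
    exact le_of_mul_le_mul_right this (width_pos hC u)
  · apply le_minRelWidth hC
    intro u
    rw [width_roundedBody hC hL hρ h, add_mul]
    linarith [minRelWidth_mul_width_le hC hE u]

end Erosion

end SuccessiveInradii

namespace SuccessiveInradii

open Set

variable {d : ℕ} {C L M S : Set (E d)} {u : UnitVec d} {ρ σ : ℝ}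

/-! ### Difference bodies and interior points -/

section Interior

open scoped Pointwise

/-- A point that no direction separates from a closed convex set belongs to it. -/
theorem mem_of_forall_exists_inner_le (hS : Convex ℝ S) (hcl : IsClosed S) (hne : S.Nonempty)
    {z : E d} (h : ∀ u : UnitVec d, ∃ s ∈ S, inner ℝ (u : E d) z ≤ inner ℝ (u : E d) s) :
    z ∈ S := by
  by_contra hz
  obtain ⟨f, a, hfa, hfz⟩ := geometric_hahn_banach_closed_point hS hcl hz
  set v : E d := (InnerProductSpace.toDual ℝ (E d)).symm f with hv
  have hvf : ∀ x, inner ℝ v x = f x := fun x => InnerProductSpace.toDual_symm_apply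
  have hv0 : v ≠ 0 := by
    intro h0
    obtain ⟨s, hs⟩ := hne
    have h1 := hfa s hs
    rw [← hvf, h0, inner_zero_left] at h1 hfz
    linarith
  obtain ⟨s, hs, hle⟩ := h ⟨‖v‖⁻¹ • v, by simp [norm_smul, hv0]⟩
  simp only [real_inner_smul_left, hvf] at hle
  have := le_of_mul_le_mul_left hle (inv_pos.2 (norm_pos_iff.2 hv0))
  linarith [hfa s hs]

/-- The difference body of `S` contains the difference body of `C`, scaled by the minimal `C`-width
of `S`. -/
theorem exists_sub_eq_minRelWidth_smul_sub (hC : IsConvexBody C) (hS : Convex ℝ S)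
    (hSc : IsCompact S) (hne : S.Nonempty) {x y : E d} (hx : x ∈ C) (hy : y ∈ C) :
    ∃ p ∈ S, ∃ q ∈ S, p - q = minRelWidth C S • (x - y) := by
  have hSS : IsCompact (S - S) := by
    rw [← sub_image_prod]
    exact (hSc.prod hSc).image continuous_sub
  have hmem : minRelWidth C S • (x - y) ∈ S - S := by
    -- The support function of S - S at u is the width of S, which is at least w(S) times the width
    -- of C.
    apply mem_of_forall_exists_inner_le (hS.sub hS) hSS.isClosed (hne.sub hne)
    intro u
    obtain ⟨p, hp, q, hq, hpq⟩ := exists_inner_sub_inner_eq_width hSc hne u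
    refine ⟨p - q, sub_mem_sub hp hq, ?_⟩
    rw [inner_sub_right, hpq, real_inner_smul_right, inner_sub_right]
    exact (mul_le_mul_of_nonneg_left (inner_sub_inner_le_width hC.isCompact u hx hy)
      (minRelWidth_nonneg hC.isCompact hSc)).trans (minRelWidth_mul_width_le hC hSc u)
  exact mem_sub.1 hmem

/-- Otherwise S lies in a hyperplane and has width zero along its normal. -/
theorem interior_nonempty_of_minRelWidth_pos (hC : IsConvexBody C) (hS : Convex ℝ S)
    (hSc : IsCompact S) (h : 0 < minRelWidth C S) : (interior S).Nonempty := by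
  have hne : S.Nonempty := by
    rw [nonempty_iff_ne_empty]; rintro rfl; simp [minRelWidth_empty] at h
  rw [hS.interior_nonempty_iff_affineSpan_eq_top,
    AffineSubspace.affineSpan_eq_top_iff_vectorSpan_eq_top_of_nonempty ℝ _ _ hne]
  by_contra htop
  rw [← Submodule.orthogonal_eq_bot_iff] at htop
  obtain ⟨v, hv, hv0⟩ := Submodule.exists_mem_ne_zero_of_ne_bot htop
  set u : UnitVec d := ⟨‖v‖⁻¹ • v, by simp [norm_smul, hv0]⟩ with hu
  obtain ⟨x, hx, y, hy, hxy⟩ := exists_inner_sub_inner_eq_width hSc hne u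
  have h0 : inner ℝ (u : E d) (x - y) = 0 := by
    have := Submodule.inner_left_of_mem_orthogonal
      (vsub_mem_vectorSpan ℝ hx hy : x -ᵥ y ∈ vectorSpan ℝ S) hv
    simp only [vsub_eq_sub] at this
    simp [hu, real_inner_smul_left, this]
  rw [← inner_sub_right, h0] at hxy
  have := minRelWidth_mul_width_le hC hSc u
  nlinarith [width_pos hC u]

theorem exists_homothet_subset_of_interior_nonempty (hC : IsCompact C)
    (h : (interior S).Nonempty) : ∃ t : E d, ∃ ε : ℝ, 0 < ε ∧ homothet t ε C ⊆ S := by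
  obtain ⟨t, ht⟩ := h
  obtain ⟨δ, hδ, hball⟩ := Metric.isOpen_iff.1 isOpen_interior t ht
  obtain ⟨R, hR, hCR⟩ := hC.isBounded.exists_pos_norm_le
  refine ⟨t, δ / (2 * R), by positivity, ?_⟩
  rintro _ ⟨c, hc, rfl⟩
  apply interior_subset (hball _)
  rw [Metric.mem_ball, dist_eq_norm, add_sub_cancel_left, norm_smul, Real.norm_eq_abs,
    abs_of_pos (by positivity)]
  calc δ / (2 * R) * ‖c‖ ≤ δ / (2 * R) * R := by gcongr; exact hCR c hc
    _ = δ / 2 := by field_simp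
    _ < δ := by linarith

end Interior

/-! ### Existence and uniqueness of the successive inradii -/

section Existence

/-- The homothetic copy of an erosion towards an inscribed copy of `ε C` survives further erosion. -/
theorem homothet_erosion_subset (hL : Convex ℝ L) {t : E d} {ε : ℝ}
    (ht : homothet t ε C ⊆ erosion C L ρ) {l : ℝ} (hl : 0 ≤ l) (hl1 : l ≤ 1) :
    homothet (l • t) (1 - l) (erosion C L ρ) ⊆ erosion C L (ρ + l * ε) := by
  have key : ∀ c ∈ C, t + (ρ + ε) • c ∈ L := fun c hc => by
    have := mem_erosion_iff.1 (ht ⟨c, hc, rfl⟩) c hc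
    convert this using 1
    module
  rintro _ ⟨s, hs, rfl⟩
  rw [mem_erosion_iff] at hs ⊢
  intro c hc
  convert hL (key c hc) (hs c hc) hl (sub_nonneg.2 hl1) (by ring) using 1
  module

theorem erosion_nonempty_of_le (hC : IsConvexBody C) (hρ : 0 ≤ ρ) (hρσ : ρ ≤ σ)
    (hne : (erosion C L σ).Nonempty) : (erosion C L ρ).Nonempty := by
  obtain ⟨t, ht⟩ := hne
  obtain ⟨c, hc⟩ := hC.nonempty
  exact ⟨_, add_smul_mem_erosion hC.convex hρ hρσ ht hc⟩

variable [Nonempty (UnitVec d)]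

/-- The minimal `C`-width of the erosion decreases at least as fast as the radius grows. -/
theorem minRelWidth_erosion_add_le (hC : IsConvexBody C) (hL : IsCompact L) (hρ : 0 ≤ ρ)
    (hρσ : ρ ≤ σ) (hne : (erosion C L σ).Nonempty) :
    minRelWidth C (erosion C L σ) + (σ - ρ) ≤ minRelWidth C (erosion C L ρ) := by
  have hEσ := isCompact_erosion (ρ := σ) hC.nonempty hL
  have hEρ := isCompact_erosion (ρ := ρ) hC.nonempty hL
  apply le_minRelWidth hC
  intro u
  obtain ⟨x, hx, y, hy, hxy⟩ := exists_inner_sub_inner_eq_width hEσ hne u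
  obtain ⟨c, hc, c', hc', hcc⟩ := exists_inner_sub_inner_eq_width hC.isCompact hC.nonempty u
  -- Extremal points of the smaller erosion, shifted by σ - ρ times extremal points of C, stay in
  -- the larger one.
  have := inner_sub_inner_le_width hEρ u (add_smul_mem_erosion hC.convex hρ hρσ hx hc)
    (add_smul_mem_erosion hC.convex hρ hρσ hy hc')
  simp only [inner_add_right, real_inner_smul_right] at this
  have h2 := minRelWidth_mul_width_le hC hEσ u
  rw [add_mul]
  rw [← hcc] at h2 ⊢
  linarith

theorem le_of_erosion_nonempty (hC : IsConvexBody C) (hL : IsCompact L) (hρ : 0 ≤ ρ)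
    (hne : (erosion C L ρ).Nonempty) : ρ ≤ minRelWidth C L := by
  have h := minRelWidth_erosion_add_le hC hL le_rfl hρ hne
  rw [erosion_zero hC.nonempty, sub_zero] at h
  linarith [minRelWidth_nonneg hC.isCompact (isCompact_erosion (ρ := ρ) hC.nonempty hL)]

/-- For a fixed direction, the radii whose erosion has two points far enough apart form a projection
of a compact set of pairs. Intersecting over all directions avoids any continuity statement about
erosions. -/
theorem isCompact_setOf_mul_le_minRelWidth_erosion (hC : IsConvexBody C) (hL : IsCompact L)
    (κ : ℝ) :
    IsCompact {ρ : ℝ | 0 ≤ ρ ∧ (erosion C L ρ).Nonempty ∧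
      κ * ρ ≤ minRelWidth C (erosion C L ρ)} := by
  set R := minRelWidth C L
  set B : UnitVec d → Set ((ℝ × E d) × (ℝ × E d)) := fun u =>
    ({p : ℝ × E d | p.1 ∈ Icc 0 R ∧ p.2 ∈ erosion C L p.1} ×ˢ
      {p : ℝ × E d | p.1 ∈ Icc 0 R ∧ p.2 ∈ erosion C L p.1}) ∩
      {q | q.1.1 = q.2.1 ∧ κ * q.1.1 * width C u ≤
        inner ℝ (u : E d) q.1.2 - inner ℝ (u : E d) q.2.2} with hB
  have hBc : ∀ u, IsCompact (B u) := fun u =>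
    ((isCompact_setOf_mem_erosion hC.nonempty hL R).prod
      (isCompact_setOf_mem_erosion hC.nonempty hL R)).inter_right
      ((isClosed_eq (f := fun q : (ℝ × E d) × (ℝ × E d) => q.1.1) (g := fun q => q.2.1)
        (by fun_prop) (by fun_prop)).inter
      (isClosed_le (f := fun q : (ℝ × E d) × (ℝ × E d) => κ * q.1.1 * width C u)
        (g := fun q => inner ℝ (u : E d) q.1.2 - inner ℝ (u : E d) q.2.2)
        (by fun_prop) (by fun_prop)))
  have heq : {ρ : ℝ | 0 ≤ ρ ∧ (erosion C L ρ).Nonempty ∧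
      κ * ρ ≤ minRelWidth C (erosion C L ρ)} = ⋂ u, (fun q => q.1.1) '' B u := by
    ext ρ
    simp only [mem_ofPred_eq, mem_iInter]
    constructor
    · rintro ⟨hρ, hne, hle⟩ u
      have hE := isCompact_erosion (ρ := ρ) hC.nonempty hL
      obtain ⟨x, hx, y, hy, hxy⟩ := exists_inner_sub_inner_eq_width hE hne u
      have hρR : ρ ∈ Icc 0 R := ⟨hρ, le_of_erosion_nonempty hC hL hρ hne⟩
      refine ⟨((ρ, x), (ρ, y)), ⟨⟨⟨hρR, hx⟩, ⟨hρR, hy⟩⟩, rfl, ?_⟩, rfl⟩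
      simp only [hxy]
      exact (mul_le_mul_of_nonneg_right hle (width_pos hC u).le).trans
        (minRelWidth_mul_width_le hC hE u)
    · intro h
      have h' : ∀ u : UnitVec d, ρ ∈ Icc 0 R ∧ ∃ x ∈ erosion C L ρ, ∃ y ∈ erosion C L ρ,
          κ * ρ * width C u ≤ inner ℝ (u : E d) x - inner ℝ (u : E d) y := by
        intro u
        obtain ⟨⟨⟨a, x⟩, ⟨b, y⟩⟩, ⟨⟨⟨ha, hx⟩, ⟨-, hy⟩⟩, hab, hle⟩, rfl⟩ := h u
        simp only at hab hle ha hx hy ⊢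
        subst hab
        exact ⟨ha, x, hx, y, hy, hle⟩
      obtain ⟨u⟩ := ‹Nonempty (UnitVec d)›
      obtain ⟨hρ, x, hx, -⟩ := h' u
      refine ⟨hρ.1, ⟨x, hx⟩, le_minRelWidth hC fun v => ?_⟩
      obtain ⟨-, x, hx, y, hy, hle⟩ := h' v
      exact hle.trans (inner_sub_inner_le_width (isCompact_erosion hC.nonempty hL) v hx hy)
  rw [heq]
  obtain ⟨u⟩ := ‹Nonempty (UnitVec d)›
  exact ((hBc u).image (by fun_prop)).of_isClosed_subset
    (isClosed_iInter fun v => ((hBc v).image (by fun_prop)).isClosed) (iInter_subset _ u)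

/-- If the erosion is wider than `κ ρ`, then so is the erosion by a slightly larger radius. -/
theorem exists_lt_mul_le_minRelWidth_erosion (hC : IsConvexBody C) (hL : IsConvexBody L)
    {κ : ℝ} (hκ : 0 ≤ κ) (hρ : 0 ≤ ρ) (h : κ * ρ < minRelWidth C (erosion C L ρ)) :
    ∃ σ, ρ < σ ∧ (erosion C L σ).Nonempty ∧ κ * σ ≤ minRelWidth C (erosion C L σ) := by
  have hE := isCompact_erosion (ρ := ρ) hC.nonempty hL.isCompact
  set g := minRelWidth C (erosion C L ρ) with hg
  have hg0 : 0 < g := (mul_nonneg hκ hρ).trans_lt h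
  have hint := interior_nonempty_of_minRelWidth_pos hC (convex_erosion hL.convex) hE hg0
  have hne := hint.mono interior_subset
  obtain ⟨t, ε, hε, ht⟩ := exists_homothet_subset_of_interior_nonempty hC.isCompact hint
  -- The solution of κ(ρ + lε) = (1 - l)g.
  set l : ℝ := (g - κ * ρ) / (g + κ * ε) with hl
  have hden : 0 < g + κ * ε := by positivity
  have hl0 : 0 < l := div_pos (by linarith) hden
  have hl1 : l ≤ 1 := (div_le_one hden).2 (by nlinarith [mul_nonneg hκ hρ, mul_nonneg hκ hε.le])
  have hsub := homothet_erosion_subset hL.convex ht hl0.le hl1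
  refine ⟨ρ + l * ε, by nlinarith, (hne.image _).mono hsub, ?_⟩
  calc κ * (ρ + l * ε) = (1 - l) * g := by rw [hl]; field_simp; ring
    _ ≤ minRelWidth C (homothet (l • t) (1 - l) (erosion C L ρ)) :=
      minRelWidth_homothet hC hE hne _ (by linarith)
    _ ≤ _ := minRelWidth_mono hC (IsCompact.homothet hE _ _) (hne.image _)
      (isCompact_erosion hC.nonempty hL.isCompact) hsub

/-- The largest ρ with κρ ≤ w(L_ρ) works, since strict inequality there would allow a larger radius.
The k-th inradius needs κ = k - 1. -/
theorem exists_minRelWidth_erosion_eq (hC : IsConvexBody C) (hL : IsConvexBody L)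
    {κ : ℝ} (hκ : 0 ≤ κ) :
    ∃ ρ, 0 < ρ ∧ (erosion C L ρ).Nonempty ∧ minRelWidth C (erosion C L ρ) = κ * ρ := by
  obtain ⟨σ, hσ, hσne, hσle⟩ := exists_lt_mul_le_minRelWidth_erosion (ρ := 0) hC hL hκ le_rfl (by
    rw [erosion_zero hC.nonempty, mul_zero]; exact minRelWidth_pos hC hL)
  obtain ⟨ρ, ⟨hρ, hne, hle⟩, hmax⟩ :=
    (isCompact_setOf_mul_le_minRelWidth_erosion hC hL.isCompact κ).exists_isGreatest
      ⟨σ, hσ.le, hσne, hσle⟩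
  refine ⟨ρ, hσ.trans_le (hmax ⟨hσ.le, hσne, hσle⟩), hne, hle.antisymm' ?_⟩
  by_contra! hlt
  obtain ⟨τ, hτ, hτne, hτle⟩ := exists_lt_mul_le_minRelWidth_erosion hC hL hκ hρ hlt
  exact hτ.not_ge (hmax ⟨hρ.trans hτ.le, hτne, hτle⟩)

theorem le_inradius_iff (hC : IsConvexBody C) (hL : IsConvexBody L) (hρ : 0 < ρ) :
    ρ ≤ inradius C L ↔ (erosion C L ρ).Nonempty := by
  have hb : BddAbove {ρ : ℝ | 0 < ρ ∧ ∃ t : E d, homothet t ρ C ⊆ L} :=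
    ⟨minRelWidth C L, fun σ hσ => le_of_erosion_nonempty hC hL.isCompact hσ.1.le hσ.2⟩
  refine ⟨fun h => ?_, fun h => le_csSup hb ⟨hρ, h⟩⟩
  obtain ⟨σ, hσ, hσne, -⟩ := exists_minRelWidth_erosion_eq hC hL le_rfl
  -- With κ = 0 the width condition is vacuous, so the supremum defining the inradius is attained.
  obtain ⟨τ, ⟨hτ, hτne, -⟩, hmax⟩ :=
    (isCompact_setOf_mul_le_minRelWidth_erosion hC hL.isCompact 0).exists_isGreatest
      ⟨σ, hσ.le, hσne, by
        rw [zero_mul]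
        exact minRelWidth_nonneg hC.isCompact (isCompact_erosion hC.nonempty hL.isCompact)⟩
  refine erosion_nonempty_of_le hC hρ.le (h.trans (csSup_le ⟨σ, hσ, hσne⟩ ?_)) hτne
  rintro x ⟨hx, hxne⟩
  refine hmax ⟨hx.le, hxne, ?_⟩
  rw [zero_mul]
  exact minRelWidth_nonneg hC.isCompact (isCompact_erosion hC.nonempty hL.isCompact)

theorem isSuccessiveInradius_iff (hC : IsConvexBody C) (hL : IsConvexBody L) {k : ℕ} :
    IsSuccessiveInradius C L k ρ ↔
      0 < ρ ∧ (erosion C L ρ).Nonempty ∧ minRelWidth C (erosion C L ρ) + ρ = k * ρ := by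
  refine and_congr_right fun hρ => ?_
  rw [le_inradius_iff hC hL hρ]
  exact and_congr_right fun h => by rw [minRelWidth_roundedBody hC hL.isCompact hρ.le h]

theorem existsUnique_isSuccessiveInradius (hC : IsConvexBody C) (hL : IsConvexBody L) {k : ℕ}
    (hk : 1 ≤ k) : ∃! ρ, IsSuccessiveInradius C L k ρ := by
  simp only [isSuccessiveInradius_iff hC hL]
  have hk' : (1 : ℝ) ≤ k := by exact_mod_cast hk
  -- As ρ grows, w(L_ρ) + ρ does not increase, while kρ strictly increases.
  have hlt : ∀ ρ σ : ℝ, 0 < ρ → ρ < σ → (erosion C L σ).Nonempty →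
      minRelWidth C (erosion C L ρ) + ρ = k * ρ →
      minRelWidth C (erosion C L σ) + σ = k * σ → False := by
    intro ρ σ hρ hρσ hne h1 h2
    have := minRelWidth_erosion_add_le hC hL.isCompact hρ.le hρσ.le hne
    nlinarith
  obtain ⟨ρ, hρ, hne, heq⟩ := exists_minRelWidth_erosion_eq (κ := k - 1) hC hL (by linarith)
  have hρk : minRelWidth C (erosion C L ρ) + ρ = k * ρ := by rw [heq]; ring
  refine ⟨ρ, ⟨hρ, hne, hρk⟩, ?_⟩
  rintro σ ⟨hσ, hσne, hσk⟩
  rcases lt_trichotomy σ ρ with h | h | h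
  · exact (hlt σ ρ hσ h hne hσk hρk).elim
  · exact h
  · exact (hlt ρ σ hρ h hσne hρk hσk).elim

theorem isSuccessiveInradius_successiveInradius (hC : IsConvexBody C) (hL : IsConvexBody L)
    {k : ℕ} (hk : 1 ≤ k) : IsSuccessiveInradius C L k (successiveInradius C L k) := by
  obtain ⟨ρ, hρ, huniq⟩ := existsUnique_isSuccessiveInradius hC hL hk
  have : {σ | IsSuccessiveInradius C L k σ} = {ρ} :=
    eq_singleton_iff_unique_mem.2 ⟨hρ, huniq⟩
  rwa [successiveInradius, this, csSup_singleton]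

end Existence

end SuccessiveInradii

namespace SuccessiveInradii

open Set

/-! ### Two planks covering a convex set -/

section TwoPlanks

variable {V : Type*} [AddCommGroup V] [Module ℝ V] {T : Set V}

/-- A convex set that avoids an open quadrant: two points sticking out on either side of the corner
cannot both stick out far. -/
theorem mul_le_mul_of_avoids_quadrant (hT : Convex ℝ T) (f g : V →ₗ[ℝ] ℝ) {a b : ℝ}
    (hcov : ∀ x ∈ T, a ≤ f x ∨ b ≤ g x) {A D : V} (hA : A ∈ T) (hD : D ∈ T) (hfA : f A < a)
    (hgD : g D < b) : (a - f A) * (b - g D) ≤ (g A - b) * (f D - a) := by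
  have hgA : b ≤ g A := (hcov A hA).resolve_left hfA.not_ge
  have hfD : a ≤ f D := (hcov D hD).resolve_right hgD.not_ge
  by_contra! hlt
  have h1 : 0 < f D - f A := by linarith
  have h2 : 0 < g A - g D := by linarith
  -- The lower bound on s puts the point (1 - s)A + sD below b in g, the upper bound puts it below a
  -- in f: it lies in the forbidden quadrant.
  obtain ⟨s, hs1, hs2⟩ := exists_between
    (show (g A - b) / (g A - g D) < (a - f A) / (f D - f A) by
      rw [div_lt_div_iff₀ h2 h1]; nlinarith)
  have hs0 : 0 ≤ s := (div_nonneg (by linarith) h2.le).trans hs1.le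
  have hs3 : s ≤ 1 := hs2.le.trans ((div_le_one h1).2 (by linarith))
  rw [div_lt_iff₀ h2] at hs1
  rw [lt_div_iff₀ h1] at hs2
  rcases hcov _ (hT hA hD (sub_nonneg.2 hs3) hs0 (by ring)) with h | h <;>
  · simp only [map_add, map_smul, smul_eq_mul] at h
    nlinarith

/-- Expanding both sides, the square terms follow from the hypotheses and the mixed term 2rpq from
their product by AM-GM. -/
theorem mul_add_sq_le {p q r x y y' z : ℝ} (hp : 0 ≤ p) (hq : 0 ≤ q) (hr : 0 ≤ r) (hx : 0 ≤ x)
    (hz : 0 ≤ z) (hy : 0 ≤ y) (hy' : 0 ≤ y') (h : p * r ≤ y * x) (h' : q * r ≤ y' * z) :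
    r * (p + q) ^ 2 ≤ (x + z) * (p * y + q * y') := by
  have h1 : 2 * (r * p * q) ≤ z * p * y + x * q * y' := by
    apply le_of_sq_le_sq _ (by positivity)
    have h3 : (p * r) * (q * r) ≤ (y * x) * (y' * z) := by gcongr
    have h4 : p * q * ((p * r) * (q * r)) ≤ p * q * ((y * x) * (y' * z)) := by gcongr
    nlinarith [sq_nonneg (z * p * y - x * q * y')]
  nlinarith [mul_le_mul_of_nonneg_left h hp, mul_le_mul_of_nonneg_left h' hq]

/-- Here p is how far A sticks out of the f-plank and y its height within the g-plank. Without
excess p = 0, and every product inequality involving p becomes trivial. -/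
theorem exists_excess (f g : V →ₗ[ℝ] ℝ) {a b c : ℝ} (hbc : b ≤ c)
    (hcov : ∀ x ∈ T, a ≤ f x ∨ (b ≤ g x ∧ g x ≤ c)) {A : V} (hA : A ∈ T) :
    ∃ p y : ℝ, 0 ≤ p ∧ a - f A ≤ p ∧ 0 ≤ y ∧ y ≤ c - b ∧
      (p = 0 ∨ (f A < a ∧ p = a - f A ∧ y = g A - b)) := by
  rcases le_or_gt a (f A) with h | h
  · exact ⟨0, 0, le_rfl, by linarith, le_rfl, by linarith, Or.inl rfl⟩
  · obtain ⟨h1, h2⟩ := (hcov A hA).resolve_left h.not_ge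
    exact ⟨a - f A, g A - b, by linarith, le_rfl, by linarith, by linarith, Or.inr ⟨h, rfl, rfl⟩⟩

/-- Two planks covering a convex set: the amounts by which the set exceeds the widths of
the planks in the respective directions have product at most the product of these widths. -/
theorem mul_le_mul_of_subset_two_planks (hT : Convex ℝ T) (f g : V →ₗ[ℝ] ℝ) {a b a' b' : ℝ}
    (hab : a ≤ b) (hab' : a' ≤ b')
    (hcov : ∀ x ∈ T, (a ≤ f x ∧ f x ≤ b) ∨ (a' ≤ g x ∧ g x ≤ b')) {A B D U : V} (hA : A ∈ T)
    (hB : B ∈ T) (hD : D ∈ T) (hU : U ∈ T) (hg : b' - a' ≤ g U - g D) :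
    (f B - f A - (b - a)) * (g U - g D - (b' - a')) ≤ (b - a) * (b' - a') := by
  obtain ⟨p, y, hp, hpA, hy, hyW, hA'⟩ := exists_excess (T := T) f g (a := a) hab'
    (fun x hx => (hcov x hx).imp_left And.left) hA
  obtain ⟨q, y', hq, hqB, hy', hyW', hB'⟩ := exists_excess (T := T) (-f) g (a := -b) hab'
    (fun x hx => (hcov x hx).imp_left fun h => neg_le_neg h.2) hB
  obtain ⟨r, x, hr, hrD, hx, hxW, hD'⟩ := exists_excess (T := T) g f (a := a') hab
    (fun x hx => (hcov x hx).symm.imp_left And.left) hD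
  obtain ⟨s, x', hs, hsU, hx', hxW', hU'⟩ := exists_excess (T := T) (-g) f (a := -b') hab
    (fun x hx => (hcov x hx).symm.imp_left fun h => neg_le_neg h.2) hU
  simp only [LinearMap.neg_apply] at hqB hB' hsU hU'
  have h1 : p * r ≤ y * x := by
    rcases hA' with rfl | ⟨hA', rfl, rfl⟩
    · rw [zero_mul]; positivity
    rcases hD' with rfl | ⟨hD', rfl, rfl⟩
    · rw [mul_zero]; positivity
    exact mul_le_mul_of_avoids_quadrant hT f g
      (fun x hx => (hcov x hx).imp And.left And.left) hA hD hA' hD'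
  have h2 : p * s ≤ (b' - a' - y) * x' := by
    have : 0 ≤ (b' - a' - y) * x' := mul_nonneg (by linarith) hx'
    rcases hA' with rfl | ⟨hA', rfl, rfl⟩
    · rwa [zero_mul]
    rcases hU' with rfl | ⟨hU', rfl, rfl⟩
    · rwa [mul_zero]
    have := mul_le_mul_of_avoids_quadrant hT f (-g) (a := a) (b := -b')
      (fun x hx => (hcov x hx).imp And.left fun h => neg_le_neg h.2) hA hU hA' (by simpa using hU')
    simp only [LinearMap.neg_apply] at this
    linarith
  have h3 : q * r ≤ y' * (b - a - x) := by
    have : 0 ≤ y' * (b - a - x) := mul_nonneg hy' (by linarith)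
    rcases hB' with rfl | ⟨hB', rfl, rfl⟩
    · rwa [zero_mul]
    rcases hD' with rfl | ⟨hD', rfl, rfl⟩
    · rwa [mul_zero]
    have := mul_le_mul_of_avoids_quadrant hT (-f) g (a := -b) (b := a')
      (fun x hx => (hcov x hx).imp (fun h => neg_le_neg h.2) And.left) hB hD (by simpa using hB') hD'
    simp only [LinearMap.neg_apply] at this
    linarith
  have h4 : q * s ≤ (b' - a' - y') * (b - a - x') := by
    have : 0 ≤ (b' - a' - y') * (b - a - x') := mul_nonneg (by linarith) (by linarith)
    rcases hB' with rfl | ⟨hB', rfl, rfl⟩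
    · rwa [zero_mul]
    rcases hU' with rfl | ⟨hU', rfl, rfl⟩
    · rwa [mul_zero]
    have := mul_le_mul_of_avoids_quadrant hT (-f) (-g) (a := -b) (b := -b')
      (fun x hx => (hcov x hx).imp (fun h => neg_le_neg h.2) fun h => neg_le_neg h.2) hB hU
      (by simpa using hB') (by simpa using hU')
    simp only [LinearMap.neg_apply] at this
    linarith
  -- In the sum of h5 and h6 the heights cancel, leaving (p + q)²(r + s) ≤ (p + q)(b - a)(b' - a').
  have h5 := mul_add_sq_le hp hq hr hx (sub_nonneg.2 hxW) hy hy' h1 h3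
  have h6 := mul_add_sq_le hp hq hs hx' (sub_nonneg.2 hxW') (sub_nonneg.2 hyW) (sub_nonneg.2 hyW')
    h2 h4
  have hPR : (f B - f A - (b - a)) * (g U - g D - (b' - a')) ≤ (p + q) * (r + s) :=
    mul_le_mul (by linarith) (by linarith) (by linarith) (by linarith)
  refine hPR.trans ?_
  rcases (add_nonneg hp hq).eq_or_lt with h0 | h0
  · rw [← h0, zero_mul]
    exact mul_nonneg (by linarith) (by linarith)
  · refine le_of_mul_le_mul_left ?_ h0
    linarith

end TwoPlanks

/-! ### Subadditivity under one cut -/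

section Subadditivity

variable {d : ℕ} {C L M S P : Set (E d)} {u : UnitVec d} {ρ σ : ℝ}

/-- The part of `S` between two parallel hyperplanes at relative distance `ρ` contributes at most
`ρ` to the minimal `C`-width. -/
theorem minRelWidth_le_add_add [Nonempty (UnitVec d)] (hC : IsConvexBody C) (hS : Convex ℝ S) (hSc : IsCompact S)
    (u : UnitVec d) (a : ℝ) (hρ : 0 ≤ ρ) :
    minRelWidth C S ≤ minRelWidth C (S ∩ {x | inner ℝ (u : E d) x ≤ a}) +
      minRelWidth C (S ∩ {x | a + ρ * width C u ≤ inner ℝ (u : E d) x}) + ρ := by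
  have hu := continuous_inner_unitVec u
  set S₁ := S ∩ {x | inner ℝ (u : E d) x ≤ a} with hS₁
  set S₂ := S ∩ {x | a + ρ * width C u ≤ inner ℝ (u : E d) x} with hS₂
  have hS₁c : IsCompact S₁ := hSc.inter_right (isClosed_le hu continuous_const)
  have hS₂c : IsCompact S₂ := hSc.inter_right (isClosed_le continuous_const hu)
  set w := minRelWidth C S with hw
  set w₁ := minRelWidth C S₁ with hw₁
  set w₂ := minRelWidth C S₂ with hw₂
  have hw₁0 : 0 ≤ w₁ := minRelWidth_nonneg hC.isCompact hS₁c
  have hw₂0 : 0 ≤ w₂ := minRelWidth_nonneg hC.isCompact hS₂c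
  by_contra! hlt
  have hw0 : 0 < w := by linarith
  have hne : S.Nonempty := by
    rw [nonempty_iff_ne_empty]; rintro rfl; simp [hw, minRelWidth_empty] at hw0
  obtain ⟨c, hc, c', hc', hcc⟩ := exists_inner_sub_inner_eq_width hC.isCompact hC.nonempty u
  obtain ⟨p, hp, q, hq, hpq⟩ := exists_sub_eq_minRelWidth_smul_sub hC hS hSc hne hc hc'
  set l := ρ / w with hl
  have hlw : l * w = ρ := div_mul_cancel₀ _ hw0.ne'
  have hl0 : 0 ≤ l := div_nonneg hρ hw0.le
  have hl1 : l ≤ 1 := (div_le_one hw0).2 (by linarith)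
  -- With l = ρ / w, v crosses the slab exactly. Shrinking S by 1 - l towards q gives T, and towards
  -- p gives T + v.
  set v : E d := l • (p - q) with hv
  have huv : inner ℝ (u : E d) v = ρ * width C u := by
    rw [hv, hpq, real_inner_smul_right, real_inner_smul_right, inner_sub_right, hcc, ← mul_assoc,
      hlw]
  set T := homothet (l • q) (1 - l) S with hT
  have hTconv : Convex ℝ T := by
    have := (hS.smul (1 - l)).translate (l • q)
    rwa [← image_smul, image_image] at this
  have hTc : IsCompact T := IsCompact.homothet hSc _ _
  have hTne : T.Nonempty := hne.image _
  have hTS : T ⊆ S := by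
    rintro _ ⟨s, hs, rfl⟩
    exact hS hq hs hl0 (sub_nonneg.2 hl1) (by ring)
  have hTvS : ∀ x ∈ T, x + v ∈ S := by
    rintro _ ⟨s, hs, rfl⟩
    convert hS hp hs hl0 (sub_nonneg.2 hl1) (by ring) using 1
    rw [hv]; module
  have hcov : ∀ x ∈ T, x ∈ S₁ ∨ x + v ∈ S₂ := by
    intro x hx
    rcases le_total (inner ℝ (u : E d) x) a with h | h
    · exact Or.inl ⟨hTS hx, h⟩
    · refine Or.inr ⟨hTvS x hx, ?_⟩
      change a + ρ * width C u ≤ inner ℝ (u : E d) (x + v)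
      rw [inner_add_right, huv]
      linarith
  have hTw : ∀ u', (w - ρ) * width C u' ≤ width T u' := by
    intro u'
    rw [width_homothet hSc hne _ (sub_nonneg.2 hl1)]
    have : w - ρ = (1 - l) * w := by rw [sub_mul, hlw, one_mul]
    rw [this, mul_assoc]
    exact mul_le_mul_of_nonneg_left (minRelWidth_mul_width_le hC hSc u') (sub_nonneg.2 hl1)
  obtain ⟨u₁, hu₁⟩ := exists_width_eq_minRelWidth_mul hC hS₁c
  obtain ⟨u₂, hu₂⟩ := exists_width_eq_minRelWidth_mul hC hS₂c
  obtain ⟨B, hB, A, hA, hBA⟩ := exists_inner_sub_inner_eq_width hTc hTne u₁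
  obtain ⟨U, hU, D, hD, hUD⟩ := exists_inner_sub_inner_eq_width hTc hTne u₂
  have hc₁ := width_pos hC u₁
  have hc₂ := width_pos hC u₂
  have hT₁ := hTw u₁
  have hT₂ := hTw u₂
  -- If one plank alone covers T, comparing widths suffices. Otherwise both remnants are nonempty
  -- and their levels are genuine.
  by_cases hall₁ : ∀ x ∈ T, x ∈ S₁
  · have := width_mono (u := u₁) hTc hTne hS₁c hall₁
    nlinarith
  by_cases hall₂ : ∀ x ∈ T, x + v ∈ S₂
  · have := inner_sub_inner_le_width hS₂c u₂ (hall₂ U hU) (hall₂ D hD)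
    simp only [inner_add_right] at this
    nlinarith
  push Not at hall₁ hall₂
  obtain ⟨x₂, hx₂, hx₂'⟩ := hall₁
  obtain ⟨x₁, hx₁, hx₁'⟩ := hall₂
  have hx₁S := (hcov x₁ hx₁).resolve_right hx₁'
  have hx₂S := (hcov x₂ hx₂).resolve_left hx₂'
  have key := mul_le_mul_of_subset_two_planks hTconv (innerₛₗ ℝ (u₁ : E d)) (innerₛₗ ℝ (u₂ : E d))
    (a := lowerLevel S₁ u₁) (b := upperLevel S₁ u₁)
    (a' := lowerLevel S₂ u₂ - inner ℝ (u₂ : E d) v) (b' := upperLevel S₂ u₂ - inner ℝ (u₂ : E d) v)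
    ((lowerLevel_le_inner hS₁c u₁ hx₁S).trans (inner_le_upperLevel hS₁c u₁ hx₁S))
    (sub_le_sub_right
      ((lowerLevel_le_inner hS₂c u₂ hx₂S).trans (inner_le_upperLevel hS₂c u₂ hx₂S)) _)
    (by
      intro x hx
      simp only [innerₛₗ_apply_apply]
      refine (hcov x hx).imp
        (fun h => ⟨lowerLevel_le_inner hS₁c u₁ h, inner_le_upperLevel hS₁c u₁ h⟩) fun h => ?_
      have h1 := lowerLevel_le_inner hS₂c u₂ h
      have h2 := inner_le_upperLevel hS₂c u₂ h
      rw [inner_add_right] at h1 h2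
      constructor <;> linarith) hA hB hD hU
  simp only [innerₛₗ_apply_apply, sub_sub_sub_cancel_right, hBA, hUD] at key
  rw [← width, ← width, hu₁, hu₂, ← hw₁, ← hw₂] at key
  -- Since w - ρ > w₁ + w₂, each excess beats the opposite relative width, so their product exceeds
  -- that of the plank widths.
  have hP : w₂ * width C u₁ < width T u₁ - w₁ * width C u₁ := by nlinarith
  have hR : w₁ * width C u₂ < width T u₂ - w₂ * width C u₂ := by nlinarith
  have hlt' := mul_lt_mul'' hP hR (by positivity) (by positivity)
  have hP0 : 0 ≤ w₂ * width C u₁ := by positivity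
  have hR0 : 0 ≤ w₁ * width C u₂ := by positivity
  have := key (by linarith)
  linarith

theorem erosion_inter_lower (hC : IsCompact C) (hne : C.Nonempty) (hρ : 0 ≤ ρ)
    (H : Hyperplane d) :
    erosion C (P ∩ H.lower) ρ = erosion C P ρ ∩
      {x | inner ℝ (H.normal : E d) x ≤ H.level - ρ * upperLevel C H.normal} := by
  ext t
  simp only [mem_erosion_iff, mem_inter_iff, Hyperplane.lower, mem_ofPred_eq, inner_add_right,
    real_inner_smul_right, forall₂_and]
  refine and_congr_right fun _ => ⟨fun h => ?_, fun h c hc => ?_⟩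
  · obtain ⟨c, hc, hcu⟩ := exists_inner_eq_upperLevel hC hne H.normal
    have := h c hc
    rw [hcu] at this
    linarith
  · have := mul_le_mul_of_nonneg_left (inner_le_upperLevel hC H.normal hc) hρ
    linarith

theorem erosion_inter_upper (hC : IsCompact C) (hne : C.Nonempty) (hρ : 0 ≤ ρ)
    (H : Hyperplane d) :
    erosion C (P ∩ H.upper) ρ = erosion C P ρ ∩
      {x | H.level - ρ * lowerLevel C H.normal ≤ inner ℝ (H.normal : E d) x} := by
  ext t
  simp only [mem_erosion_iff, mem_inter_iff, Hyperplane.upper, mem_ofPred_eq, inner_add_right,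
    real_inner_smul_right, forall₂_and]
  refine and_congr_right fun _ => ⟨fun h => ?_, fun h c hc => ?_⟩
  · obtain ⟨c, hc, hcu⟩ := exists_inner_eq_lowerLevel hC hne H.normal
    have := h c hc
    rw [hcu] at this
    linarith
  · have := mul_le_mul_of_nonneg_left (lowerLevel_le_inner hC H.normal hc) hρ
    linarith

/-- The eroded half-spaces end at the cut level shifted by ρ times the upper and lower level of C,
so the lost slab has relative width exactly ρ. -/
theorem minRelWidth_erosion_le_cut [Nonempty (UnitVec d)] (hC : IsConvexBody C)
    (hP : IsConvexBody P) (hρ : 0 ≤ ρ) (H : Hyperplane d) :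
    minRelWidth C (erosion C P ρ) ≤ minRelWidth C (erosion C (P ∩ H.lower) ρ) +
      minRelWidth C (erosion C (P ∩ H.upper) ρ) + ρ := by
  have hlevel : H.level - ρ * lowerLevel C H.normal =
      H.level - ρ * upperLevel C H.normal + ρ * width C H.normal := by
    rw [width]; ring
  rw [erosion_inter_lower hC.isCompact hC.nonempty hρ,
    erosion_inter_upper hC.isCompact hC.nonempty hρ, hlevel]
  exact minRelWidth_le_add_add hC (convex_erosion hP.convex)
    (isCompact_erosion hC.nonempty hP.isCompact) H.normal _ hρ

end Subadditivity

end SuccessiveInradii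

namespace SuccessiveInradii

open Set Filter Topology

variable {d : ℕ} {C K L P Q : Set (E d)} {u : UnitVec d} {ρ : ℝ} {m n : ℕ}

/-! ### The lower bound for arbitrary slicings -/

section LowerBound

variable [Nonempty (UnitVec d)]

/-- Each cut adds one piece, whose extra summand ρ pays for the slab lost at the cut. -/
theorem SlicedBy.minRelWidth_erosion_add_le_sum (hC : IsConvexBody C) (hK : IsConvexBody K)
    {cuts : List (Hyperplane d)} {pieces : Multiset (Set (E d))} (h : SlicedBy K cuts pieces)
    (hρ : 0 ≤ ρ) :
    minRelWidth C (erosion C K ρ) + ρ ≤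
      (pieces.map fun P => minRelWidth C (erosion C P ρ) + ρ).sum := by
  induction h with
  | uncut => simp
  | cut cuts P rest H before divides ih =>
    have hP := before.isConvexBody hK P (Multiset.mem_cons_self _ _)
    have := minRelWidth_erosion_le_cut hC hP hρ H
    simp only [Multiset.map_cons, Multiset.sum_cons] at ih ⊢
    linarith

theorem successiveInradius_pos (hC : IsConvexBody C) (hL : IsConvexBody L) (hm : 1 ≤ m) :
    0 < successiveInradius C L m :=
  (isSuccessiveInradius_successiveInradius hC hL hm).1

theorem minRelWidth_erosion_le_of_successiveInradius_le (hC : IsConvexBody C)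
    (hL : IsConvexBody L) (hm : 1 ≤ m) (h : successiveInradius C L m ≤ ρ) :
    minRelWidth C (erosion C L ρ) + ρ ≤ m * ρ := by
  obtain ⟨h0, -, heq⟩ := (isSuccessiveInradius_iff hC hL).1
    (isSuccessiveInradius_successiveInradius hC hL hm)
  have hm' : (1 : ℝ) ≤ m := by exact_mod_cast hm
  rcases (erosion C L ρ).eq_empty_or_nonempty with he | hne
  · rw [he, minRelWidth_empty]
    nlinarith
  · have := minRelWidth_erosion_add_le hC hL.isCompact h0.le h hne
    nlinarith

theorem lt_minRelWidth_erosion_of_lt_successiveInradius (hC : IsConvexBody C)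
    (hL : IsConvexBody L) (hm : 1 ≤ m) (hρ : 0 ≤ ρ) (h : ρ < successiveInradius C L m) :
    (erosion C L ρ).Nonempty ∧ m * ρ < minRelWidth C (erosion C L ρ) + ρ := by
  obtain ⟨h0, hne, heq⟩ := (isSuccessiveInradius_iff hC hL).1
    (isSuccessiveInradius_successiveInradius hC hL hm)
  have hm' : (1 : ℝ) ≤ m := by exact_mod_cast hm
  refine ⟨erosion_nonempty_of_le hC hρ h.le hne, ?_⟩
  have := minRelWidth_erosion_add_le hC hL.isCompact hρ h.le hne
  nlinarith

/-- However `K` is sliced into `n` pieces, some piece has a large `m`-th successive inradius. -/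
theorem SlicedBy.exists_successiveInradius_le (hC : IsConvexBody C) (hK : IsConvexBody K)
    (hm : 1 ≤ m) (hn : 1 ≤ n) {cuts : List (Hyperplane d)} {pieces : Multiset (Set (E d))}
    (h : SlicedBy K cuts pieces) (hcard : pieces.card = n) :
    ∃ P ∈ pieces, successiveInradius C K (m * n) ≤ successiveInradius C P m := by
  by_contra! hlt
  set r := successiveInradius C K (m * n) with hr
  have hr0 : 0 < r := successiveInradius_pos hC hK (Nat.mul_pos hm hn)
  -- A radius strictly below r is needed: at r itself the estimate for K is an equality and gives no
  -- contradiction.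
  have hev : ∀ᶠ ρ in 𝓝[<] r, ∀ P ∈ {P | P ∈ pieces}, successiveInradius C P m < ρ :=
    (eventually_all_finite pieces.finite_toSet).2 fun P hP =>
      (eventually_gt_nhds (hlt P hP)).filter_mono nhdsWithin_le_nhds
  obtain ⟨ρ, hPρ, hρ0, hρr⟩ := (hev.and
    (((eventually_gt_nhds hr0).filter_mono nhdsWithin_le_nhds).and
      eventually_mem_nhdsWithin)).exists
  have h1 := h.minRelWidth_erosion_add_le_sum hC hK hρ0.le
  have h2 := (lt_minRelWidth_erosion_of_lt_successiveInradius hC hK (Nat.mul_pos hm hn) hρ0.le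
    hρr).2
  have h3 : (pieces.map fun P => minRelWidth C (erosion C P ρ) + ρ).sum ≤
      (pieces.map fun P => minRelWidth C (erosion C P ρ) + ρ).card • (m * ρ) := by
    apply Multiset.sum_le_card_nsmul
    intro x hx
    obtain ⟨P, hP, rfl⟩ := Multiset.mem_map.1 hx
    exact minRelWidth_erosion_le_of_successiveInradius_le hC (h.isConvexBody hK P hP) hm
      (hPρ P hP).le
  rw [Multiset.card_map, hcard, nsmul_eq_mul] at h3
  push_cast at h2
  linarith

theorem successiveInradius_le_of_minRelWidth_le (hC : IsConvexBody C) (hL : IsConvexBody L)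
    (hm : 1 ≤ m) (hρ : 0 ≤ ρ)
    (h : (erosion C L ρ).Nonempty → minRelWidth C (erosion C L ρ) + ρ ≤ m * ρ) :
    successiveInradius C L m ≤ ρ := by
  by_contra! hlt
  obtain ⟨hne, hw⟩ := lt_minRelWidth_erosion_of_lt_successiveInradius hC hL hm hρ hlt
  exact (h hne).not_gt hw

/-- A part of `K` that meets the rounded body of `K` in a narrow strip has a small `m`-th successive
inradius. -/
theorem successiveInradius_le_of_strip (hC : IsConvexBody C) (hQ : IsConvexBody Q) (hm : 1 ≤ m)
    (hρ : 0 ≤ ρ) (hQK : Q ⊆ K) (u : UnitVec d) {a : ℝ}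
    (h : ∀ x ∈ Q, x ∈ roundedBody C K ρ →
      a ≤ inner ℝ (u : E d) x ∧ inner ℝ (u : E d) x ≤ a + m * ρ * width C u) :
    successiveInradius C Q m ≤ ρ := by
  refine successiveInradius_le_of_minRelWidth_le hC hQ hm hρ fun hne => ?_
  rw [← minRelWidth_roundedBody hC hQ.isCompact hρ hne]
  have hR := isCompact_roundedBody (ρ := ρ) hC.isCompact hC.nonempty hQ.isCompact
  refine le_of_mul_le_mul_right ((minRelWidth_mul_width_le hC hR u).trans ?_) (width_pos hC u)
  apply width_le_of_forall hR (roundedBody_nonempty hC.nonempty hne)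
  intro x hx y hy
  have hx' := h x (roundedBody_subset hx) (roundedBody_mono hQK hx)
  have hy' := h y (roundedBody_subset hy) (roundedBody_mono hQK hy)
  linarith [hx'.2, hy'.1]

end LowerBound

/-! ### Optimality of equally spaced parallel cuts -/

section EquallySpaced

/-- The hyperplanes strictly between two parallel supporting hyperplanes meet the interior. -/
theorem exists_mem_interior_inner_eq (hK : IsConvexBody K) (u : UnitVec d) {a : ℝ}
    (hl : lowerLevel K u < a) (hu : a < upperLevel K u) :
    ∃ x ∈ interior K, inner ℝ (u : E d) x = a := by
  have hcont := continuous_inner_unitVec u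
  have hcl : K ⊆ closure (interior K) := by
    rw [hK.convex.closure_interior_eq_closure_of_nonempty_interior hK.interior_nonempty]
    exact subset_closure
  obtain ⟨x, hx, hxu⟩ := exists_inner_eq_lowerLevel hK.isCompact hK.nonempty u
  obtain ⟨y, hy, hyu⟩ := exists_inner_eq_upperLevel hK.isCompact hK.nonempty u
  -- The interior is dense in K, so it has points strictly on both sides of the hyperplane.
  obtain ⟨x', hx'a, hx'⟩ := mem_closure_iff.1 (hcl hx) {z | inner ℝ (u : E d) z < a}
    (isOpen_lt hcont continuous_const) (by simpa only [mem_ofPred_eq, hxu] using hl)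
  obtain ⟨y', hy'a, hy'⟩ := mem_closure_iff.1 (hcl hy) {z | a < inner ℝ (u : E d) z}
    (isOpen_lt continuous_const hcont) (by simpa only [mem_ofPred_eq, hyu] using hu)
  obtain ⟨z, hz, hza⟩ := hK.convex.interior.isPreconnected.intermediate_value hx' hy'
    hcont.continuousOn ⟨hx'a.le, hy'a.le⟩
  exact ⟨z, hz, hza⟩

theorem equallySpacedCuts_eq_map (L : Set (E d)) (u : UnitVec d) (n : ℕ) :
    equallySpacedCuts L u n = (List.range (n - 1)).map fun i : ℕ => Hyperplane.mk u
      (lowerLevel L u + ((i : ℝ) + 1) * (width L u / n)) := by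
  simp only [equallySpacedCuts, List.pure_def, List.bind_eq_flatMap, ← List.map_eq_flatMap,
    List.map_map]
  rfl

variable [Nonempty (UnitVec d)]

/-- Cutting off strips of relative width `m ρ` from the rounded body one after the other. -/
theorem exists_slicedBy_parallel (hC : IsConvexBody C) (hK : IsConvexBody K) (hm : 1 ≤ m)
    (hρ : 0 < ρ) (hne : (erosion C K ρ).Nonempty) (u : UnitVec d)
    (hw : width (roundedBody C K ρ) u = n * (m * ρ * width C u)) :
    ∀ j : ℕ, j + 1 ≤ n → ∃ (P : Set (E d)) (rest : Multiset (Set (E d))),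
      SlicedBy K ((List.range j).map fun i : ℕ => Hyperplane.mk u
        (lowerLevel (roundedBody C K ρ) u + ((i : ℝ) + 1) * (m * ρ * width C u))) (P ::ₘ rest) ∧
      P ⊆ K ∧
      (∀ x ∈ interior K, lowerLevel (roundedBody C K ρ) u + j * (m * ρ * width C u) <
        inner ℝ (u : E d) x → x ∈ interior P) ∧
      (∀ x ∈ P, x ∈ roundedBody C K ρ →
        lowerLevel (roundedBody C K ρ) u + j * (m * ρ * width C u) ≤ inner ℝ (u : E d) x) ∧
      ∀ Q ∈ rest, successiveInradius C Q m ≤ ρ := by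
  have hcont := continuous_inner_unitVec u
  have hR := isCompact_roundedBody (ρ := ρ) hC.isCompact hC.nonempty hK.isCompact
  have hRne := roundedBody_nonempty hC.nonempty hne
  set R := roundedBody C K ρ with hRdef
  set h := m * ρ * width C u with hh
  have hh0 : 0 < h := mul_pos (mul_pos (by exact_mod_cast hm) hρ) (width_pos hC u)
  have hlow : lowerLevel K u ≤ lowerLevel R u := by
    obtain ⟨x, hx, hxu⟩ := exists_inner_eq_lowerLevel hR hRne u
    exact hxu ▸ lowerLevel_le_inner hK.isCompact u (roundedBody_subset hx)
  have hupp : upperLevel R u ≤ upperLevel K u := by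
    obtain ⟨x, hx, hxu⟩ := exists_inner_eq_upperLevel hR hRne u
    exact hxu ▸ inner_le_upperLevel hK.isCompact u (roundedBody_subset hx)
  intro j
  induction j with
  | zero =>
    intro _
    refine ⟨K, 0, SlicedBy.uncut, subset_rfl, fun x hx _ => hx, fun x _ hx => ?_, by simp⟩
    simpa using lowerLevel_le_inner hR u hx
  | succ j ih =>
    intro hj
    obtain ⟨P, rest, hsl, hPK, hint, hstrip, hrest⟩ := ih (by omega)
    set H : Hyperplane d := ⟨u, lowerLevel R u + ((j : ℝ) + 1) * h⟩ with hH
    -- Strictness keeps the cut below the upper supporting hyperplane of R, so it meets the interior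
    -- of K.
    have hjn : (j : ℝ) + 1 < n := by exact_mod_cast hj
    have hdiv : (interior P ∩ H.points).Nonempty := by
      obtain ⟨x, hx, hxu⟩ := exists_mem_interior_inner_eq hK u
        (a := lowerLevel R u + ((j : ℝ) + 1) * h) (by nlinarith [j.cast_nonneg (α := ℝ)]) (by
          have : upperLevel R u = lowerLevel R u + n * h := by rw [← hw, width]; ring
          nlinarith)
      exact ⟨x, hint x hx (by rw [hxu]; linarith), hxu⟩
    have hcut := SlicedBy.cut _ P rest H hsl hdiv
    have hbody := hcut.isConvexBody hK (P ∩ H.lower) (Multiset.mem_cons_self _ _)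
    -- The upper part becomes the piece to be cut next; the lower part is final.
    rw [Multiset.cons_swap] at hcut
    refine ⟨P ∩ H.upper, (P ∩ H.lower) ::ₘ rest, ?_, inter_subset_left.trans hPK, ?_, ?_, ?_⟩
    · rw [List.range_succ, List.map_append]
      exact hcut
    · intro x hx hxu
      push_cast at hxu
      rw [interior_inter]
      refine ⟨hint x hx (by linarith), ?_⟩
      exact interior_maximal (s := H.upper) (t := {y | H.level < inner ℝ (u : E d) y})
        (fun y (hy : H.level < inner ℝ (u : E d) y) => hy.le) (isOpen_lt continuous_const hcont) hxu
    · intro x hx _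
      push_cast
      exact hx.2
    · intro Q hQ
      rcases Multiset.mem_cons.1 hQ with rfl | hQ
      · refine successiveInradius_le_of_strip (K := K) hC hbody hm hρ.le
          (inter_subset_left.trans hPK) u (a := lowerLevel R u + j * h) fun x hx hxR =>
          ⟨hstrip x hx.1 hxR, ?_⟩
        have : inner ℝ (u : E d) x ≤ lowerLevel R u + ((j : ℝ) + 1) * h := hx.2
        linarith
      · exact hrest Q hQ

theorem exists_slicedBy_equallySpacedCuts (hC : IsConvexBody C) (hK : IsConvexBody K) (hm : 1 ≤ m)
    (hn : 1 ≤ n) (hρ : 0 < ρ) (hne : (erosion C K ρ).Nonempty) (u : UnitVec d)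
    (hw : width (roundedBody C K ρ) u = n * (m * ρ * width C u)) :
    ∃ pieces : Multiset (Set (E d)),
      SlicedBy K (equallySpacedCuts (roundedBody C K ρ) u n) pieces ∧
      ∀ P ∈ pieces, successiveInradius C P m ≤ ρ := by
  obtain ⟨P, rest, hsl, hPK, -, hstrip, hrest⟩ :=
    exists_slicedBy_parallel hC hK hm hρ hne u hw (n - 1) (by omega)
  have hn0 : (n : ℝ) ≠ 0 := by positivity
  have hR := isCompact_roundedBody (ρ := ρ) hC.isCompact hC.nonempty hK.isCompact
  refine ⟨P ::ₘ rest, ?_, fun Q hQ => ?_⟩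
  · rw [equallySpacedCuts_eq_map, hw, mul_div_cancel_left₀ _ hn0]
    exact hsl
  rcases Multiset.mem_cons.1 hQ with rfl | hQ
  · refine successiveInradius_le_of_strip hC
      (hsl.isConvexBody hK _ (Multiset.mem_cons_self _ _)) hm hρ.le hPK u fun x hx hxR =>
      ⟨hstrip x hx hxR, ?_⟩
    -- The last strip is bounded above by the supporting hyperplane of the rounded body instead of a
    -- cut.
    have h1 := inner_le_upperLevel hR u hxR
    rw [width] at hw
    rw [Nat.cast_sub hn, Nat.cast_one]
    linarith
  · exact hrest Q hQ

theorem exists_isGreatestInradius_equallySpacedCuts (hC : IsConvexBody C) (hK : IsConvexBody K)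
    (hm : 1 ≤ m) (hn : 1 ≤ n) (hρ : ρ = successiveInradius C K (m * n)) (u : UnitVec d)
    (hu : relWidth C (roundedBody C K ρ) u = minRelWidth C (roundedBody C K ρ)) :
    ∃ pieces : Multiset (Set (E d)), pieces.card = n ∧
      SlicedBy K (equallySpacedCuts (roundedBody C K ρ) u n) pieces ∧
      IsGreatestInradius C m pieces ρ := by
  have hs := isSuccessiveInradius_successiveInradius hC hK (Nat.mul_pos hm hn)
  rw [← hρ] at hs
  obtain ⟨hρ0, hne, -⟩ := (isSuccessiveInradius_iff hC hK).1 hs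
  rw [hs.2.2, relWidth, div_eq_iff (width_pos hC u).ne'] at hu
  obtain ⟨pieces, hsl, hle⟩ := exists_slicedBy_equallySpacedCuts hC hK hm hn hρ0 hne u
    (by rw [hu]; push_cast; ring)
  have hcard : pieces.card = n := by
    rw [hsl.card_pieces, equallySpacedCuts_eq_map, List.length_map, List.length_range]
    omega
  obtain ⟨P, hP, hPle⟩ := hsl.exists_successiveInradius_le hC hK hm hn hcard
  refine ⟨pieces, hcard, hsl, ⟨P, hP, (hρ.trans_le hPle).antisymm (hle P hP)⟩, ?_⟩
  rintro _ ⟨Q, hQ, rfl⟩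
  exact hle Q hQ

end EquallySpaced

end SuccessiveInradii

/-! ### Conclusion -/

theorem theorem2p1 (d : ℕ) (hd : 2 ≤ d) (K C : Set (E d))
    (hK : IsConvexBody K) (hC : IsConvexBody C) (m n : ℕ) (hm : 1 ≤ m) (hn : 1 ≤ n) :
    -- the successive `C`-inradii are well defined
    (∀ L : Set (E d), IsConvexBody L → ∀ k : ℕ, 1 ≤ k →
      ∃! ρ : ℝ, IsSuccessiveInradius C L k ρ) ∧
    -- the minimum, over all slicings, of the greatest `m`-th successive inradius of the pieces
    IsLeast
      {M : ℝ | ∃ (cuts : List (Hyperplane d)) (pieces : Multiset (Set (E d))),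
        cuts.length = n - 1 ∧ pieces.card = n ∧ SlicedBy K cuts pieces ∧
        IsGreatestInradius C m pieces M}
      (successiveInradius C K (m * n)) ∧
    -- the minimal `C`-width of the rounded body is attained in some direction
    (∃ u : UnitVec d,
      relWidth C (roundedBody C K (successiveInradius C K (m * n))) u =
        minRelWidth C (roundedBody C K (successiveInradius C K (m * n)))) ∧
    -- equally spaced parallel cuts along any such direction are optimal
    (∀ u : UnitVec d,
      relWidth C (roundedBody C K (successiveInradius C K (m * n))) u =
        minRelWidth C (roundedBody C K (successiveInradius C K (m * n))) →
      ∃ pieces : Multiset (Set (E d)),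
        pieces.card = n ∧
        SlicedBy K
          (equallySpacedCuts (roundedBody C K (successiveInradius C K (m * n))) u n) pieces ∧
        IsGreatestInradius C m pieces (successiveInradius C K (m * n))) := by
  have : Nontrivial (E d) := by
    have : Nontrivial (Fin d) := Fin.nontrivial_iff_two_le.2 hd
    infer_instance
  have : Nonempty (UnitVec d) := (NormedSpace.sphere_nonempty.2 zero_le_one).to_subtype
  have hmin := exists_relWidth_eq_minRelWidth hC (isCompact_roundedBody
    (ρ := successiveInradius C K (m * n)) hC.isCompact hC.nonempty hK.isCompact)
  refine ⟨fun L hL k hk => existsUnique_isSuccessiveInradius hC hL hk, ⟨?_, ?_⟩, hmin,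
    fun u hu => exists_isGreatestInradius_equallySpacedCuts hC hK hm hn rfl u hu⟩
  · obtain ⟨u, hu⟩ := hmin
    obtain ⟨pieces, hcard, hsl, hgr⟩ :=
      exists_isGreatestInradius_equallySpacedCuts hC hK hm hn rfl u hu
    exact ⟨_, pieces, by simp [equallySpacedCuts_eq_map], hcard, hsl, hgr⟩
  · rintro M ⟨cuts, pieces, -, hcard, hsl, hgr⟩
    obtain ⟨P, hP, hle⟩ := hsl.exists_successiveInradius_le hC hK hm hn hcard
    exact hle.trans (hgr.2 ⟨P, hP, rfl⟩)
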